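/- Let $G$ be a group. Its lower $\mathbb{Q}$-central series is defined by $\gamma_1^{\mathbb{Q}}G=G$ and $\gamma_{i+1}^{\mathbb{Q}}G=\operatorname{Ker}\bigl(\gamma_i^{\mathbb{Q}}G\to(\gamma_i^{\mathbb{Q}}G/[\gamma_i^{\mathbb{Q}}G,G])\otimes\mathbb{Q}\bigr)$. The group $G$ is called $\mathbb{Q}$-prenilpotent if $\gamma_i^{\mathbb{Q}}G=\gamma_{i+1}^{\mathbb{Q}}G$ for all sufficiently large $i$. The $\mathbb{Q}$-completion of $G$ is $\hat G_{\mathbb{Q}}=\varprojlim_i\,(G/\gamma_i^{\mathbb{Q}}G)\otimes\mathbb{Q}$, where $N\otimes\mathbb{Q}$ denotes the Malcev completion (rationalisation) of a nilpotent group $N$; it is a topological group with the inverse limit topology of discrete groups. For a topological group $\Gamma$ whose left and right uniform structures coincide, the uniform cohomology $H^*_u(\Gamma,\mathbb{Q})$ is the cohomology of the complex of those inhomogeneous cochains $\Gamma^n\to\mathbb{Q}$ that are uniformly continuous, where $\mathbb{Q}$ is discrete with trivial action; $\Gamma$ is called cohomologically discrete over $\mathbb{Q}$ if the natural map $H^m_u(\Gamma,\mathbb{Q})\to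 H^m(\Gamma,\mathbb{Q})$ to the cohomology of the abstract group $\Gamma$ is an isomorphism for every $m\ge 0$. The group $G$ is called $H\mathbb{Q}$-good if the canonical map $G\to\hat G_{\mathbb{Q}}$ induces an isomorphism $H_1(G,\mathbb{Q})\to H_1(\hat G_{\mathbb{Q}},\mathbb{Q})$ and an epimorphism $H_2(G,\mathbb{Q})\to H_2(\hat G_{\mathbb{Q}},\mathbb{Q})$ (homology of abstract groups). Proposition. Let $G$ be a solvable group with a finite sequence of normal subgroups $G=U_1\supseteq U_2\supseteq\dots\supseteq U_s=1$ such that every factor $U_i/U_{i+1}$ is abelian and $(U_i/U_{i+1})\otimes\mathbb{Q}$ is finite dimensional over $\mathbb{Q}$. Then $G$ is $\mathbb{Q}$-prenilpotent, and $\hat G_{\mathbb{Q}}$ is cohomologically discrete over $\mathbb{Q}$. Moreover, if $G$ is finitely generated, then $G$ is $H\mathbb{Q}$-good. -/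

import Mathlib

open scoped TensorProduct
open CategoryTheory

universe u v w

namespace RationalCompletion

section RationalLowerCentralSeries

variable {G : Type u} [Group G]

/-- For a normal subgroup `N` of `G`, the quotient `N / [N, G]`. -/
abbrev CommutatorQuotient (N : Subgroup G) [N.Normal] : Type u :=
  N ⧸ (⁅N, (⊤ : Subgroup G)⁆.subgroupOf N)

instance (N : Subgroup G) [N.Normal] : CommGroup (CommutatorQuotient N) where
  mul_comm := by
    intro a b
    induction a using QuotientGroup.induction_on with
    | H x =>
      induction b using QuotientGroup.induction_on with
      | H y =>
        refine QuotientGroup.eq.2 ?_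
        rw [Subgroup.mem_subgroupOf]
        have h := Subgroup.commutator_mem_commutator (H₁ := N) (H₂ := (⊤ : Subgroup G))
          (N.inv_mem y.2) (Subgroup.mem_top ((x : G)⁻¹))
        simpa [commutatorElement_def, mul_assoc] using h

/-- The homomorphism `N → N / [N, G] ⊗ ℚ`, `x ↦ x̄ ⊗ 1`, written with a multiplicative target. -/
def toRationalQuotient (N : Subgroup G) [N.Normal] :
    N →* Multiplicative (Additive (CommutatorQuotient N) ⊗[ℤ] ℚ) :=
  (AddMonoidHom.toMultiplicativeRight
    ((TensorProduct.mk ℤ (Additive (CommutatorQuotient N)) ℚ).flip 1).toAddMonoidHom).comp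
    (QuotientGroup.mk' (⁅N, (⊤ : Subgroup G)⁆.subgroupOf N))

/-- One step of the rational lower central series: the kernel of `N → N / [N, G] ⊗ ℚ`. -/
def rationalStep (N : Subgroup G) [N.Normal] : Subgroup G :=
  (toRationalQuotient N).ker.map N.subtype

theorem rationalStep_le (N : Subgroup G) [N.Normal] : rationalStep N ≤ N := by
  rintro _ ⟨x, -, rfl⟩
  exact x.2

theorem commutator_le_rationalStep (N : Subgroup G) [N.Normal] :
    ⁅N, (⊤ : Subgroup G)⁆ ≤ rationalStep N := by
  intro x hx
  refine ⟨⟨x, Subgroup.commutator_le_left N ⊤ hx⟩, ?_, rfl⟩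
  have h : (QuotientGroup.mk' (⁅N, (⊤ : Subgroup G)⁆.subgroupOf N))
      ⟨x, Subgroup.commutator_le_left N ⊤ hx⟩ = 1 :=
    (QuotientGroup.eq_one_iff _).2 hx
  change (toRationalQuotient N) _ = 1
  rw [toRationalQuotient, MonoidHom.comp_apply, h, map_one]

instance rationalStep_normal (N : Subgroup G) [N.Normal] : (rationalStep N).Normal where
  conj_mem := by
    intro x hx g
    have h : x⁻¹ * (g * x * g⁻¹) ∈ rationalStep N := by
      refine commutator_le_rationalStep N ?_
      have := Subgroup.commutator_mem_commutator (H₁ := N) (H₂ := (⊤ : Subgroup G))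
        (N.inv_mem (rationalStep_le N hx)) (Subgroup.mem_top g)
      simpa [commutatorElement_def, mul_assoc] using this
    simpa using (rationalStep N).mul_mem hx h

variable (G) in
/-- The rational lower central series together with its normality. -/
def gammaAux : ℕ → {N : Subgroup G // N.Normal}
  | 0 => ⟨⊤, inferInstance⟩
  | i + 1 =>
    haveI := (gammaAux i).2
    ⟨rationalStep (gammaAux i).1, inferInstance⟩

variable (G) in
/-- The lower `ℚ`-central series `γ₁ = G`, `γᵢ₊₁ = Ker (γᵢ → γᵢ / [γᵢ, G] ⊗ ℚ)`. The numbering here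
starts from `0`, so that `gamma G i` is the usual `γᵢ₊₁`. -/
def gamma (i : ℕ) : Subgroup G := (gammaAux G i).1

instance gamma_normal (i : ℕ) : (gamma G i).Normal := (gammaAux G i).2

theorem gamma_zero : gamma G 0 = ⊤ := rfl

theorem gamma_succ (i : ℕ) : gamma G (i + 1) = rationalStep (gamma G i) := rfl

theorem gamma_antitone : Antitone (gamma G) :=
  antitone_nat_of_succ_le fun i => rationalStep_le (gamma G i)

variable (G) in
/-- A group is `ℚ`-prenilpotent if its lower `ℚ`-central series stabilises. -/
def IsQPrenilpotent : Prop := ∃ m : ℕ, ∀ i, m ≤ i → gamma G i = gamma G (i + 1)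

end RationalLowerCentralSeries

section Malcev

/-- A group is uniquely divisible if for each `n ≥ 1` every element has exactly one
`n`-th root. -/
def IsUniquelyDivisible (M : Type u) [Group M] : Prop :=
  ∀ n : ℕ+, Function.Bijective fun x : M => x ^ (n : ℕ)

/-- Formal expressions in elements of `N`, built with the group operations and with `n`-th roots
for `n ≥ 1`. -/
inductive MalcevTerm (N : Type u) : Type u
  | of (g : N) : MalcevTerm N
  | one : MalcevTerm N
  | mul (x y : MalcevTerm N) : MalcevTerm N
  | inv (x : MalcevTerm N) : MalcevTerm N
  | root (n : ℕ+) (x : MalcevTerm N) : MalcevTerm N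

/-- The formal power of an expression. -/
def MalcevTerm.pow {N : Type u} (x : MalcevTerm N) : ℕ → MalcevTerm N
  | 0 => .one
  | n + 1 => .mul (MalcevTerm.pow x n) x

/-- The smallest congruence on expressions for which the quotient is a group, `of` is a
homomorphism, and `root n` is inverse to the `n`-th power map. -/
inductive MalcevRel (N : Type u) [Group N] : MalcevTerm N → MalcevTerm N → Prop
  | refl (x) : MalcevRel N x x
  | symm {x y} : MalcevRel N x y → MalcevRel N y x
  | trans {x y z} : MalcevRel N x y → MalcevRel N y z → MalcevRel N x z
  | mul_congr {x x' y y'} : MalcevRel N x x' → MalcevRel N y y' →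
      MalcevRel N (.mul x y) (.mul x' y')
  | inv_congr {x x'} : MalcevRel N x x' → MalcevRel N (.inv x) (.inv x')
  | root_congr (n) {x x'} : MalcevRel N x x' → MalcevRel N (.root n x) (.root n x')
  | mul_assoc (x y z) : MalcevRel N (.mul (.mul x y) z) (.mul x (.mul y z))
  | one_mul (x) : MalcevRel N (.mul .one x) x
  | mul_one (x) : MalcevRel N (.mul x .one) x
  | inv_mul (x) : MalcevRel N (.mul (.inv x) x) .one
  | of_mul (g h : N) : MalcevRel N (.of (g * h)) (.mul (.of g) (.of h))
  | root_pow (n : ℕ+) (x) : MalcevRel N (.pow (.root n x) n) x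
  | pow_root (n : ℕ+) (x) : MalcevRel N (.root n (.pow x n)) x

/-- The congruence `MalcevRel` as a setoid. -/
def malcevSetoid (N : Type u) [Group N] : Setoid (MalcevTerm N) :=
  ⟨MalcevRel N, ⟨.refl, .symm, .trans⟩⟩

/-- The Malcev completion `N ⊗ ℚ` of a nilpotent group `N`, i.e. its rationalisation: the
homomorphism `N → N ⊗ ℚ` is universal among homomorphisms from `N` to uniquely divisible groups
(see `MalcevCompletion.isUniquelyDivisible` and `MalcevCompletion.lift_unique`), and `N ⊗ ℚ` is
itself nilpotent (see `MalcevCompletion.isNilpotent`), so that it is also universal among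
homomorphisms from `N` to uniquely divisible nilpotent groups. -/
def MalcevCompletion (N : Type u) [Group N] : Type u := Quotient (malcevSetoid N)

namespace MalcevCompletion

variable {N : Type u} [Group N]

instance : Group (MalcevCompletion N) where
  mul := Quotient.map₂ MalcevTerm.mul fun _ _ h _ _ h' => MalcevRel.mul_congr h h'
  one := Quotient.mk _ MalcevTerm.one
  inv := Quotient.map MalcevTerm.inv fun _ _ h => MalcevRel.inv_congr h
  mul_assoc := by
    rintro ⟨x⟩ ⟨y⟩ ⟨z⟩
    exact Quotient.sound (MalcevRel.mul_assoc x y z)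
  one_mul := by
    rintro ⟨x⟩
    exact Quotient.sound (MalcevRel.one_mul x)
  mul_one := by
    rintro ⟨x⟩
    exact Quotient.sound (MalcevRel.mul_one x)
  inv_mul_cancel := by
    rintro ⟨x⟩
    exact Quotient.sound (MalcevRel.inv_mul x)

/-- The class of an expression. -/
def mk (x : MalcevTerm N) : MalcevCompletion N := Quotient.mk (malcevSetoid N) x

theorem mk_pow (x : MalcevTerm N) (n : ℕ) : mk (x.pow n) = mk x ^ n := by
  induction n with
  | zero => rfl
  | succ n ih =>
    rw [pow_succ, ← ih]
    rfl

/-- The canonical homomorphism `N → N ⊗ ℚ`. -/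
def of : N →* MalcevCompletion N :=
  MonoidHom.mk' (fun g => mk (.of g)) fun g h => Quotient.sound (MalcevRel.of_mul g h)

theorem isUniquelyDivisible : IsUniquelyDivisible (MalcevCompletion N) := by
  intro n
  constructor
  · rintro ⟨x⟩ ⟨y⟩ h
    have h' : mk (x.pow n) = mk (y.pow n) := by
      rw [mk_pow, mk_pow]
      exact h
    exact Quotient.sound (.trans (.symm (.pow_root n x))
      (.trans (.root_congr n (Quotient.exact h')) (.pow_root n y)))
  · rintro ⟨x⟩
    refine ⟨mk (.root n x), ?_⟩
    change mk (.root n x) ^ (n : ℕ) = mk x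
    rw [← mk_pow]
    exact Quotient.sound (.root_pow n x)

section lift

variable {M : Type v} [Group M] (hM : IsUniquelyDivisible M) (f : N →* M)

/-- The value of an expression in a uniquely divisible group. -/
noncomputable def eval : MalcevTerm N → M
  | .of g => f g
  | .one => 1
  | .mul x y => eval x * eval y
  | .inv x => (eval x)⁻¹
  | .root n x => Function.surjInv (hM n).2 (eval x)

theorem eval_pow (x : MalcevTerm N) (n : ℕ) : eval hM f (x.pow n) = eval hM f x ^ n := by
  induction n with
  | zero => simp [MalcevTerm.pow, eval]
  | succ n ih => simp [MalcevTerm.pow, eval, ih, pow_succ]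

theorem eval_eq {x y : MalcevTerm N} (h : MalcevRel N x y) : eval hM f x = eval hM f y := by
  induction h with
  | refl x => rfl
  | symm _ ih => exact ih.symm
  | trans _ _ ih ih' => exact ih.trans ih'
  | mul_congr _ _ ih ih' => simp only [eval, ih, ih']
  | inv_congr _ ih => simp only [eval, ih]
  | root_congr n _ ih => simp only [eval, ih]
  | mul_assoc x y z => simp only [eval, _root_.mul_assoc]
  | one_mul x => simp only [eval, _root_.one_mul]
  | mul_one x => simp only [eval, _root_.mul_one]
  | inv_mul x => simp only [eval, inv_mul_cancel]
  | of_mul g h => simp only [eval, map_mul]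
  | root_pow n x =>
    rw [eval_pow]
    exact Function.surjInv_eq (hM n).2 (eval hM f x)
  | pow_root n x =>
    refine (hM n).1 ?_
    change (Function.surjInv (hM n).2 (eval hM f (x.pow n))) ^ (n : ℕ) = eval hM f x ^ (n : ℕ)
    rw [← eval_pow]
    exact Function.surjInv_eq (hM n).2 _

/-- The extension of a homomorphism from `N` to a uniquely divisible group. -/
noncomputable def lift : MalcevCompletion N →* M :=
  MonoidHom.mk' (Quotient.lift (eval hM f) fun _ _ h => eval_eq hM f h) (by
    rintro ⟨x⟩ ⟨y⟩
    rfl)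

@[simp]
theorem lift_of (g : N) : lift hM f (of g) = f g := rfl

end lift

/-- A subgroup closed under roots that contains the image of `N` is everything. -/
theorem eq_top_of_root_closed (H : Subgroup (MalcevCompletion N)) (hof : ∀ g, of g ∈ H)
    (hroot : ∀ (n : ℕ+) (x : MalcevCompletion N), x ^ (n : ℕ) ∈ H → x ∈ H) : H = ⊤ := by
  rw [eq_top_iff]
  rintro ⟨x⟩ -
  change mk x ∈ H
  induction x with
  | of g => exact hof g
  | one => exact H.one_mem
  | mul x y hx hy => exact H.mul_mem hx hy
  | inv x hx => exact H.inv_mem hx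
  | root n x hx =>
    refine hroot n _ ?_
    rw [← mk_pow]
    have h : mk ((MalcevTerm.root n x).pow n) = mk x := Quotient.sound (MalcevRel.root_pow n x)
    rwa [h]

theorem hom_ext {M : Type v} [Group M] (hM : IsUniquelyDivisible M)
    {f g : MalcevCompletion N →* M} (h : ∀ x : N, f (of x) = g (of x)) : f = g := by
  have := eq_top_of_root_closed (f.eqLocus g) h fun n x hx => (hM n).1 (by
    change f x ^ (n : ℕ) = g x ^ (n : ℕ)
    rw [← map_pow, ← map_pow]
    exact hx)
  ext x
  have hx : x ∈ f.eqLocus g := this ▸ Subgroup.mem_top x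
  exact hx

/-- The universal property of `N → N ⊗ ℚ`. -/
theorem lift_unique {M : Type v} [Group M] (hM : IsUniquelyDivisible M) (f : N →* M) :
    ∃! F : MalcevCompletion N →* M, MonoidHom.comp F of = f :=
  ⟨lift hM f, rfl, fun _ hF => hom_ext hM fun x => DFunLike.congr_fun hF x⟩

/-- A uniquely divisible group generated, as a uniquely divisible group, by the image of a
nilpotent group is nilpotent. -/
theorem isNilpotent_of_generated (N : Type u) [Group N] [Group.IsNilpotent N] :
    ∀ (M : Type u) [Group M], IsUniquelyDivisible M → ∀ f : N →* M,
      (∀ H : Subgroup M, (∀ g, f g ∈ H) → (∀ (n : ℕ+) (x : M), x ^ (n : ℕ) ∈ H → x ∈ H) → H = ⊤) →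
      Group.IsNilpotent M := by
  refine Group.nilpotent_center_quotient_ind
    (P := fun N _ _ => ∀ (M : Type u) [Group M], IsUniquelyDivisible M → ∀ f : N →* M,
      (∀ H : Subgroup M, (∀ g, f g ∈ H) → (∀ (n : ℕ+) (x : M), x ^ (n : ℕ) ∈ H → x ∈ H) → H = ⊤) →
      Group.IsNilpotent M) N ?_ ?_
  · intro N _ _ M _ hM f hgen
    have h := hgen ⊥ (fun g => by
      rw [Subsingleton.elim g 1, map_one]
      exact Subgroup.one_mem _) (fun n x hx => by
      rw [Subgroup.mem_bot] at hx ⊢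
      exact (hM n).1 (by simpa using hx))
    have : Subsingleton M := by
      rw [← Subgroup.subsingleton_iff]
      exact subsingleton_of_bot_eq_top h
    infer_instance
  · intro N _ _ ih M _ hM f hgen
    have hcent : ∀ z ∈ Subgroup.center N, f z ∈ Subgroup.center M := by
      intro z hz
      have h := hgen (Subgroup.centralizer {f z}) (fun g => by
        rw [Subgroup.mem_centralizer_singleton_iff, ← map_mul, ← map_mul,
          Subgroup.mem_center_iff.1 hz g]) (fun n x hx => by
        rw [Subgroup.mem_centralizer_singleton_iff] at hx ⊢
        have h1 : f z * x * (f z)⁻¹ = x := (hM n).1 (by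
          change (f z * x * (f z)⁻¹) ^ (n : ℕ) = x ^ (n : ℕ)
          rw [conj_pow, ← hx, mul_inv_cancel_right])
        rw [eq_comm, ← mul_inv_eq_iff_eq_mul, h1])
      rw [Subgroup.mem_center_iff]
      intro g
      have hg : g ∈ Subgroup.centralizer {f z} := h ▸ Subgroup.mem_top g
      exact Subgroup.mem_centralizer_singleton_iff.1 hg
    have hle : Subgroup.center N ≤
        (Subgroup.center M).comap f := fun z hz => hcent z hz
    have hroot : ∀ (n : ℕ+) (x : M), x ^ (n : ℕ) ∈ Subgroup.center M →
        x ∈ Subgroup.center M := by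
      intro n x hx
      rw [Subgroup.mem_center_iff] at hx ⊢
      intro g
      have h1 : g * x * g⁻¹ = x := (hM n).1 (by
        change (g * x * g⁻¹) ^ (n : ℕ) = x ^ (n : ℕ)
        rw [conj_pow, hx g, mul_inv_cancel_right])
      rw [← mul_inv_eq_iff_eq_mul, h1]
    refine Group.of_quotient_center_nilpotent (ih (M ⧸ Subgroup.center M) ?_
      (QuotientGroup.map _ _ f hle) ?_)
    · intro n
      constructor
      · intro a b
        induction a using QuotientGroup.induction_on with
        | H x =>
          induction b using QuotientGroup.induction_on with
          | H y =>
            intro h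
            replace h : ((x ^ (n : ℕ) : M) : M ⧸ Subgroup.center M) = (y ^ (n : ℕ) : M) := h
            have hz := QuotientGroup.eq.1 h
            obtain ⟨w, hw⟩ := (hM n).2 ((x ^ (n : ℕ))⁻¹ * y ^ (n : ℕ))
            change w ^ (n : ℕ) = _ at hw
            have hwc : w ∈ Subgroup.center M := hroot n w (hw ▸ hz)
            have hxy : x * w = y := (hM n).1 (by
              change (x * w) ^ (n : ℕ) = y ^ (n : ℕ)
              have hc : Commute x w := Subgroup.mem_center_iff.1 hwc x
              rw [hc.mul_pow, hw, mul_inv_cancel_left])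
            refine QuotientGroup.eq.2 ?_
            rw [← hxy, inv_mul_cancel_left]
            exact hwc
      · intro a
        induction a using QuotientGroup.induction_on with
        | H x =>
          obtain ⟨y, hy⟩ := (hM n).2 x
          exact ⟨(y : M ⧸ Subgroup.center M),
            congrArg (QuotientGroup.mk : M → M ⧸ Subgroup.center M) hy⟩
    · intro H hH hHroot
      have h := hgen (H.comap (QuotientGroup.mk' _)) (fun g => hH (g : N ⧸ Subgroup.center N))
        (fun n x hx => hHroot n _ (by
          have := Subgroup.mem_comap.1 hx
          rwa [map_pow] at this))
      rw [eq_top_iff]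
      intro a _
      induction a using QuotientGroup.induction_on with
      | H x =>
        have hx : x ∈ H.comap (QuotientGroup.mk' _) := h ▸ Subgroup.mem_top x
        exact hx

/-- The Malcev completion of a nilpotent group is nilpotent. -/
theorem isNilpotent [Group.IsNilpotent N] : Group.IsNilpotent (MalcevCompletion N) :=
  isNilpotent_of_generated N (MalcevCompletion N) isUniquelyDivisible of eq_top_of_root_closed

/-- The functoriality of the Malcev completion. -/
noncomputable def map {M : Type v} [Group M] (f : N →* M) :
    MalcevCompletion N →* MalcevCompletion M :=
  lift isUniquelyDivisible (of.comp f)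

end MalcevCompletion

end Malcev

section Completion

variable (G : Type u) [Group G]

/-- The homomorphism `G / γⱼ ⊗ ℚ → G / γᵢ ⊗ ℚ` for `i ≤ j`. -/
noncomputable def transition {i j : ℕ} (h : i ≤ j) :
    MalcevCompletion (G ⧸ gamma G j) →* MalcevCompletion (G ⧸ gamma G i) :=
  MalcevCompletion.map (QuotientGroup.map _ _ (MonoidHom.id G) (gamma_antitone h))

/-- The `ℚ`-completion of `G` as a subgroup of the product: the inverse limit of the groups
`G / γᵢ ⊗ ℚ`. -/
noncomputable def completionSubgroup :
    Subgroup (∀ i : ℕ, MalcevCompletion (G ⧸ gamma G i)) where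
  carrier := {x | ∀ i j : ℕ, ∀ h : i ≤ j, transition G h (x j) = x i}
  mul_mem' := by
    intro x y hx hy i j h
    simp [map_mul, hx i j h, hy i j h]
  one_mem' := by
    intro i j h
    simp
  inv_mem' := by
    intro x hx i j h
    simp [hx i j h]

/-- The `ℚ`-completion `Ĝ = lim G / γᵢ ⊗ ℚ`. -/
abbrev QCompletion : Type u := completionSubgroup G

/-- The projection of the completion onto `G / γᵢ ⊗ ℚ`. -/
noncomputable def QCompletion.proj (i : ℕ) :
    QCompletion G →* MalcevCompletion (G ⧸ gamma G i) :=
  (Pi.evalMonoidHom _ i).comp (completionSubgroup G).subtype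

/-- The uniform structure (hence the topology) of the inverse limit of the discrete
groups `G / γᵢ ⊗ ℚ`. -/
noncomputable instance : UniformSpace (QCompletion G) :=
  ⨅ i : ℕ, UniformSpace.comap (QCompletion.proj G i) ⊥

instance : IsUniformGroup (QCompletion G) := by
  refine isUniformGroup_iInf fun i => ?_
  let : UniformSpace (MalcevCompletion (G ⧸ gamma G i)) := ⊥
  have : IsUniformGroup (MalcevCompletion (G ⧸ gamma G i)) := inferInstance
  exact IsUniformGroup.comap (QCompletion.proj G i)

/-- The canonical homomorphism `G → Ĝ`. -/
noncomputable def toQCompletion : G →* QCompletion G where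
  toFun g := ⟨fun _ => MalcevCompletion.of (QuotientGroup.mk g), fun _ _ _ => rfl⟩
  map_one' := Subtype.ext (funext fun i => map_one
    (MalcevCompletion.of.comp (QuotientGroup.mk' (gamma G i))))
  map_mul' g h := Subtype.ext (funext fun i => map_mul
    (MalcevCompletion.of.comp (QuotientGroup.mk' (gamma G i))) g h)

end Completion

section UniformCohomology

variable (S : Type u) [CommRing S] (Γ : Type u) [Group Γ] [UniformSpace Γ]

/-- The module of uniform cochains `Γⁿ → S`, i.e. of uniformly continuous maps, where `S` carries
the discrete uniform structure. -/
def uniformCochain (n : ℕ) : Submodule S ((Fin n → Γ) → Rep.trivial S Γ S) where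
  carrier := {f | @UniformContinuous (Fin n → Γ) S _ ⊥ f}
  add_mem' := by
    intro f g hf hg
    let : UniformSpace S := ⊥
    exact UniformContinuous.comp (g := fun p : S × S => p.1 + p.2)
      (DiscreteUniformity.uniformContinuous _ _) (hf.prodMk hg)
  zero_mem' := by
    let : UniformSpace S := ⊥
    exact uniformContinuous_const
  smul_mem' := by
    intro c f hf
    let : UniformSpace S := ⊥
    exact UniformContinuous.comp (g := fun s : S => c * s)
      (DiscreteUniformity.uniformContinuous _ _) hf

variable [IsUniformGroup Γ]

theorem d_mem_uniformCochain (n : ℕ) (f : (Fin n → Γ) → Rep.trivial S Γ S)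
    (hf : f ∈ uniformCochain S Γ n) :
    (inhomogeneousCochains.d (Rep.trivial S Γ S) n).hom f ∈ uniformCochain S Γ (n + 1) := by
  let : UniformSpace S := ⊥
  replace hf : @UniformContinuous (Fin n → Γ) S _ ⊥ f := hf
  have h : (inhomogeneousCochains.d (Rep.trivial S Γ S) n).hom f =
      (fun g => f fun i => g i.succ) + ∑ j : Fin (n + 1),
        (-1 : S) ^ ((j : ℕ) + 1) • fun g => f (Fin.contractNth j (· * ·) g) := by
    ext g
    simp [inhomogeneousCochains.d_hom_apply]
  rw [h]
  refine Submodule.add_mem _ ?_ (Submodule.sum_mem _ fun j _ => Submodule.smul_mem _ _ ?_)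
  · exact hf.comp (uniformContinuous_pi.2 fun i => Pi.uniformContinuous_proj (fun _ => Γ) i.succ)
  · refine hf.comp (uniformContinuous_pi.2 fun i => ?_)
    unfold Fin.contractNth
    split_ifs
    · exact Pi.uniformContinuous_proj _ _
    · exact (Pi.uniformContinuous_proj (fun _ => Γ) _).mul (Pi.uniformContinuous_proj (fun _ => Γ) _)
    · exact Pi.uniformContinuous_proj _ _

/-- The complex of uniform cochains, a subcomplex of the complex of all inhomogeneous cochains with
trivial coefficients `S`. Its cohomology is the uniform cohomology of `Γ`. -/
noncomputable def uniformCochains : CochainComplex (ModuleCat.{u} S) ℕ :=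
  CochainComplex.of (fun n => ModuleCat.of S (uniformCochain S Γ n))
    (fun n => ModuleCat.ofHom
      ((inhomogeneousCochains.d (Rep.trivial S Γ S) n).hom.restrict
        (d_mem_uniformCochain S Γ n))) (by
    intro n
    refine ModuleCat.hom_ext (LinearMap.ext fun f => Subtype.ext ?_)
    exact congrArg (fun F => F.hom f.1)
      (groupCohomology.inhomogeneousCochains.d_comp_d n (Rep.trivial S Γ S)))

/-- The inclusion of the uniform cochains into all cochains. -/
noncomputable def uniformInclusion :
    uniformCochains S Γ ⟶ groupCohomology.inhomogeneousCochains (Rep.trivial S Γ S) :=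
  CochainComplex.ofHom
    (fun n => ModuleCat.ofHom (uniformCochain S Γ n).subtype) (by
    intro n
    dsimp only [uniformCochains]
    rw [CochainComplex.of_d, CochainComplex.of_d]
    rfl)

/-- `Γ` is cohomologically discrete over `S` if the natural map from the uniform cohomology to the
cohomology of the abstract group `Γ` is an isomorphism in each degree. -/
def IsCohomologicallyDiscrete : Prop :=
  ∀ m : ℕ, IsIso (HomologicalComplex.homologyMap (uniformInclusion S Γ) m)

end UniformCohomology

section Goodness

/-- The map `Hₙ(G, S) → Hₙ(Γ, S)` on homology with trivial coefficients which is induced by a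
homomorphism `G → Γ`. -/
noncomputable def homologyMap (S : Type u) [CommRing S] {G Γ : Type u} [Group G] [Group Γ]
    (f : G →* Γ) (n : ℕ) :
    groupHomology (Rep.trivial S G S) n ⟶ groupHomology (Rep.trivial S Γ S) n :=
  groupHomology.map (A := Rep.trivial S G S) (B := Rep.trivial S Γ S) f (𝟙 (Rep.trivial S G S)) n

/-- The field of rational numbers, in the universe `u`. -/
abbrev RationalField : Type u := ULift.{u} ℚ

/-- A group `G` is `Hℚ`-good if `G → Ĝ` induces an isomorphism on `H₁(-, ℚ)` and an
epimorphism on `H₂(-, ℚ)`. -/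
def IsHQGood (G : Type u) [Group G] : Prop :=
  Function.Bijective (homologyMap RationalField.{u} (toQCompletion G) 1).hom ∧
    Function.Surjective (homologyMap RationalField.{u} (toQCompletion G) 2).hom

end Goodness

/-- The group `A` is abelian and `A ⊗ ℚ` is finite dimensional over `ℚ`. -/
def IsAbelianOfFiniteRationalRank (A : Type u) [Group A] : Prop :=
  ∃ h : ∀ a b : A, a * b = b * a,
    letI : CommGroup A := { ‹Group A› with mul_comm := h }
    Module.Finite ℚ (ℚ ⊗[ℤ] Additive A)

end RationalCompletion

/-! Stability: each factor of the series `U` maps with torsion kernel to a finite dimensional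
rational space, where the images of the subgroups γⱼ ∩ Uᵢ span a decreasing chain of subspaces. Once
these finitely many chains are constant, every element of γⱼ has a power in γⱼ₊₁
(`isQPrenilpotent_of_series`). As γⱼ/γⱼ₊₁ is torsion-free, γⱼ = γⱼ₊₁.

Let γₘ be the last term. Then Ĝ is just (G/γₘ) ⊗ ℚ (`completionEquiv`) and its uniformity is
discrete. Hence every cochain is uniform, which gives cohomological discreteness.

Goodness rests on `LiftsCentralExtensions`. Let E be a central extension of Ĝ by a uniquely
divisible V. Then E is uniquely divisible, and any lift G → E of G → Ĝ kills γₘ, so it extends to Ĝ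
by the universal property of the Malcev completion. In cohomological terms, H¹(Ĝ, V) → H¹(G, V) is
bijective and H²(Ĝ, V) → H²(G, V) is injective for all rational V. The homological statements follow
by taking for V suitable quotients of chain spaces. -/

namespace RationalCompletion

/-! ### Stabilisation of the rational lower central series. -/

section Stabilisation

/-- Tensoring with ℚ is localisation at the nonzero integers, so the kernel of A → ℚ ⊗ A is torsion.
-/
theorem exists_nsmul_eq_zero_of_one_tmul_eq_zero {A : Type u} [AddCommGroup A] {a : A}
    (h : (1 : ℚ) ⊗ₜ[ℤ] a = 0) : ∃ n : ℕ, 0 < n ∧ n • a = 0 := by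
  obtain ⟨⟨c, hc⟩, h⟩ := (IsLocalizedModule.eq_zero_iff (nonZeroDivisors ℤ)
    (TensorProduct.mk ℤ ℚ A 1)).1 h
  have hc0 : c ≠ 0 := nonZeroDivisors.ne_zero hc
  replace h : c • a = 0 := h
  refine ⟨c.natAbs, Int.natAbs_pos.2 hc0, ?_⟩
  rw [← natCast_zsmul]
  rcases Int.natAbs_eq c with h' | h'
  · rwa [← h']
  · rw [h', neg_smul, neg_eq_zero] at h
    exact h

variable {G : Type u} [Group G]

/-- The quotient of `N` by `rationalStep N` embeds in a rational vector space and is therefore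
torsion-free. -/
theorem mem_rationalStep_of_pow_mem {N : Subgroup G} [N.Normal] {x : G} (hx : x ∈ N) {n : ℕ}
    (hn : 0 < n) (h : x ^ n ∈ rationalStep N) : x ∈ rationalStep N := by
  refine ⟨⟨x, hx⟩, ?_, rfl⟩
  obtain ⟨y, hy, hyx⟩ := h
  have hyx' : y = ⟨x, hx⟩ ^ n := Subtype.ext hyx
  rw [hyx'] at hy
  replace hy : toRationalQuotient N _ = 1 := hy
  rw [map_pow] at hy
  change toRationalQuotient N _ = 1
  generalize toRationalQuotient N ⟨x, hx⟩ = t at hy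
  have h1 : n • t.toAdd = 0 := hy
  -- After the swap ℚ acts through the left factor, so `n` can be cancelled as a nonzero scalar.
  have h2 : n • (TensorProduct.comm ℤ _ _ t.toAdd) = 0 := by
    rw [← map_nsmul, h1, map_zero]
  rw [← Nat.cast_smul_eq_nsmul ℚ, smul_eq_zero] at h2
  have h3 := h2.resolve_left (by exact_mod_cast hn.ne')
  exact (LinearEquiv.map_eq_zero_iff _).1 h3

theorem exists_pow_mem_commutator {N : Subgroup G} [N.Normal] {x : G}
    (h : x ∈ rationalStep N) : ∃ n : ℕ, 0 < n ∧ x ^ n ∈ ⁅N, (⊤ : Subgroup G)⁆ := by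
  obtain ⟨y, hy, rfl⟩ := h
  have h1 : (Additive.ofMul (QuotientGroup.mk y : CommutatorQuotient N)) ⊗ₜ[ℤ] (1 : ℚ) = 0 := hy
  have h2 := congrArg (TensorProduct.comm ℤ _ _) h1
  rw [TensorProduct.comm_tmul, map_zero] at h2
  obtain ⟨n, hn, h3⟩ := exists_nsmul_eq_zero_of_one_tmul_eq_zero h2
  refine ⟨n, hn, ?_⟩
  have h4 : ((y ^ n : N) : CommutatorQuotient N) = 1 := h3
  exact Subgroup.mem_subgroupOf.1 ((QuotientGroup.eq_one_iff _).1 h4)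

/-- A homomorphism from `A` to a finite dimensional rational vector space whose kernel is
torsion. -/
theorem IsAbelianOfFiniteRationalRank.exists_hom {A : Type u} [Group A]
    (h : IsAbelianOfFiniteRationalRank A) :
    ∃ (V : Type u) (_ : AddCommGroup V) (_ : Module ℚ V) (_ : Module.Finite ℚ V)
      (φ : A →* Multiplicative V), ∀ a, φ a = 1 → ∃ n : ℕ, 0 < n ∧ a ^ n = 1 := by
  obtain ⟨hc, hfin⟩ := h
  let _ : CommGroup A := { ‹Group A› with mul_comm := hc }
  refine ⟨ℚ ⊗[ℤ] Additive A, inferInstance, inferInstance, hfin,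
    AddMonoidHom.toMultiplicativeRight (TensorProduct.mk ℤ ℚ (Additive A) 1).toAddMonoidHom, ?_⟩
  intro a ha
  exact exists_nsmul_eq_zero_of_one_tmul_eq_zero (A := Additive A) ha

/-- An element of the rational span of the image of a subgroup has a positive multiple in the
image. -/
theorem exists_nsmul_mem_of_mem_span {V : Type u} [AddCommGroup V] [Module ℚ V]
    (B : AddSubgroup V) {v : V} (hv : v ∈ Submodule.span ℚ (B : Set V)) :
    ∃ n : ℕ, 0 < n ∧ n • v ∈ B := by
  induction hv using Submodule.span_induction with
  | mem x hx => exact ⟨1, one_pos, by simpa using hx⟩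
  | zero => exact ⟨1, one_pos, by simp⟩
  | add x y _ _ hx hy =>
    obtain ⟨n, hn, hx⟩ := hx
    obtain ⟨m, hm, hy⟩ := hy
    refine ⟨n * m, Nat.mul_pos hn hm, ?_⟩
    rw [smul_add]
    refine B.add_mem ?_ ?_
    · rw [mul_comm, mul_smul]
      exact B.nsmul_mem hx m
    · rw [mul_smul]
      exact B.nsmul_mem hy n
  | smul q x _ hx =>
    obtain ⟨n, hn, hx⟩ := hx
    -- The factor `q.den` clears the denominator of `q`, leaving an integer multiple of `n • x`.
    refine ⟨q.den * n, Nat.mul_pos q.den_pos hn, ?_⟩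
    have h : (q.den * n) • q • x = q.num • n • x := by
      rw [← Nat.cast_smul_eq_nsmul ℚ, ← Nat.cast_smul_eq_nsmul ℚ n, ← Int.cast_smul_eq_zsmul ℚ,
        smul_smul, smul_smul]
      congr 1
      push_cast
      rw [mul_right_comm, Rat.den_mul_eq_num]
    rw [h]
    exact B.zsmul_mem hx _

/-- The rational span of the image of `H ∩ D`. -/
def spanImage {D : Subgroup G} {V : Type u} [AddCommGroup V] [Module ℚ V]
    (φ : D →* Multiplicative V) (H : Subgroup G) : Submodule ℚ V :=
  Submodule.span ℚ (((H.subgroupOf D).map φ).toAddSubgroup' : Set V)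

theorem spanImage_mono {D : Subgroup G} {V : Type u} [AddCommGroup V] [Module ℚ V]
    (φ : D →* Multiplicative V) : Monotone (spanImage φ) := by
  intro H H' h
  refine Submodule.span_mono ?_
  rintro _ ⟨x, hx, rfl⟩
  exact ⟨x, h hx, rfl⟩

/-- One layer of the series: a multiple of `φ x` is `φ y` with `y` in `H'`, so up to a further power
`x ^ n * y⁻¹` drops into the next layer `D'`, where the claim is already known. -/
theorem exists_pow_mem_of_spanImage_le {D D' H H' : Subgroup G} [H'.Normal] {V : Type u}
    [AddCommGroup V] [Module ℚ V] (φ : D →* Multiplicative V)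
    (hφ : ∀ a, φ a = 1 → ∃ n : ℕ, 0 < n ∧ (a : G) ^ n ∈ D') (hle : H' ≤ H)
    (hspan : spanImage φ H ≤ spanImage φ H')
    (hD' : ∀ x ∈ D', x ∈ H → ∃ n : ℕ, 0 < n ∧ x ^ n ∈ H') :
    ∀ x ∈ D, x ∈ H → ∃ n : ℕ, 0 < n ∧ x ^ n ∈ H' := by
  intro x hxD hxH
  have hx : Multiplicative.toAdd (φ ⟨x, hxD⟩) ∈ spanImage φ H' :=
    hspan (Submodule.subset_span ⟨⟨x, hxD⟩, hxH, rfl⟩)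
  obtain ⟨n, hn, y, hy, hyx⟩ := exists_nsmul_mem_of_mem_span _ hx
  replace hyx : φ y = φ ⟨x, hxD⟩ ^ n := hyx
  replace hy : (y : G) ∈ H' := hy
  obtain ⟨k, hk, hmem⟩ := hφ (⟨x, hxD⟩ ^ n * y⁻¹) (by
    rw [map_mul, map_pow, map_inv, hyx, mul_inv_cancel])
  have hmem' : (x ^ n * (y : G)⁻¹) ^ k ∈ D' := hmem
  obtain ⟨l, hl, h⟩ := hD' _ hmem'
    (H.pow_mem (H.mul_mem (H.pow_mem hxH n) (H.inv_mem (hle hy))) k)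
  refine ⟨n * k * l, by positivity, ?_⟩
  -- Modulo `H'` the element `y` disappears, so the power of `x ^ n * y⁻¹` becomes a power of `x`.
  rw [← QuotientGroup.eq_one_iff] at h ⊢
  have hy1 : ((y : G) : G ⧸ H') = 1 := (QuotientGroup.eq_one_iff _).2 hy
  simpa [hy1, pow_mul] using h

theorem isQPrenilpotent_of_series (s : ℕ) (U : Fin (s + 1) → Subgroup G) [∀ i, (U i).Normal]
    (hfirst : U 0 = ⊤) (hlast : U (Fin.last s) = ⊥)
    (hfactor : ∀ i : Fin s, IsAbelianOfFiniteRationalRank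
      (U i.castSucc ⧸ (U i.succ).subgroupOf (U i.castSucc))) : IsQPrenilpotent G := by
  have h1 := fun i => (hfactor i).exists_hom
  choose V i1 i2 i3 φ hφ using h1
  let ψ : ∀ i : Fin s, U i.castSucc →* Multiplicative (V i) :=
    fun i => (φ i).comp (QuotientGroup.mk' _)
  have hψ : ∀ (i : Fin s) (a : U i.castSucc), ψ i a = 1 →
      ∃ n : ℕ, 0 < n ∧ (a : G) ^ n ∈ U i.succ := by
    intro i a ha
    obtain ⟨n, hn, h⟩ := hφ i a ha
    refine ⟨n, hn, ?_⟩
    have h' : ((a ^ n : U i.castSucc) : U i.castSucc ⧸ (U i.succ).subgroupOf (U i.castSucc)) = 1 :=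
      h
    exact Subgroup.mem_subgroupOf.1 ((QuotientGroup.eq_one_iff _).1 h')
  -- Descending chain condition in the finite dimensional space `V i`.
  have hstab : ∀ i : Fin s, ∃ m : ℕ, ∀ j, m ≤ j →
      spanImage (ψ i) (gamma G m) = spanImage (ψ i) (gamma G j) := fun i =>
    IsArtinian.monotone_stabilizes
      ⟨fun j => OrderDual.toDual (spanImage (ψ i) (gamma G j)),
        fun _ _ h => spanImage_mono (ψ i) (gamma_antitone h)⟩
  choose m hm using hstab
  refine ⟨Finset.univ.sup m, fun j hj => le_antisymm ?_ (gamma_antitone (Nat.le_succ j))⟩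
  -- Induction from the trivial end of the series up to `U 0 = ⊤`.
  have key : ∀ i : Fin (s + 1), ∀ x ∈ U i, x ∈ gamma G j →
      ∃ n : ℕ, 0 < n ∧ x ^ n ∈ gamma G (j + 1) := by
    intro i
    induction i using Fin.reverseInduction with
    | last =>
      intro x hx _
      rw [hlast, Subgroup.mem_bot] at hx
      exact ⟨1, one_pos, by simp [hx]⟩
    | cast i ih =>
      have hmj : m i ≤ j := (Finset.le_sup (Finset.mem_univ i)).trans hj
      exact exists_pow_mem_of_spanImage_le (ψ i) (hψ i) (gamma_antitone (Nat.le_succ j))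
        ((hm i j hmj).symm.trans (hm i (j + 1) (hmj.trans (Nat.le_succ j)))).le ih
  intro x hx
  obtain ⟨n, hn, h⟩ := key 0 x (hfirst ▸ Subgroup.mem_top x) hx
  exact mem_rationalStep_of_pow_mem (N := gamma G j) hx hn h

end Stabilisation
-- The completion of a group whose series is stationary.
section StableCompletion

variable {G : Type u} [Group G]

/-- The homomorphism `G / γⱼ ⊗ ℚ → G / γᵢ ⊗ ℚ` for `γⱼ ≤ γᵢ`. -/
noncomputable def malcevQuotientMap {i j : ℕ} (h : gamma G j ≤ gamma G i) :
    MalcevCompletion (G ⧸ gamma G j) →* MalcevCompletion (G ⧸ gamma G i) :=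
  MalcevCompletion.map (QuotientGroup.map _ _ (MonoidHom.id G) h)

theorem malcevQuotient_hom_ext {i : ℕ} {M : Type v} [Group M] (hM : IsUniquelyDivisible M)
    {f g : MalcevCompletion (G ⧸ gamma G i) →* M}
    (h : ∀ x : G, f (MalcevCompletion.of (QuotientGroup.mk x)) =
      g (MalcevCompletion.of (QuotientGroup.mk x))) : f = g :=
  MalcevCompletion.hom_ext hM fun x => QuotientGroup.induction_on x h

theorem malcevQuotientMap_comp {i j k : ℕ} (h : gamma G j ≤ gamma G i) (h' : gamma G k ≤ gamma G j)
    (x : MalcevCompletion (G ⧸ gamma G k)) :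
    malcevQuotientMap h (malcevQuotientMap h' x) = malcevQuotientMap (h'.trans h) x :=
  DFunLike.congr_fun (malcevQuotient_hom_ext (f := (malcevQuotientMap h).comp (malcevQuotientMap h'))
    (g := malcevQuotientMap (h'.trans h))
    MalcevCompletion.isUniquelyDivisible fun _ => rfl) x

theorem malcevQuotientMap_self {i : ℕ} (h : gamma G i ≤ gamma G i)
    (x : MalcevCompletion (G ⧸ gamma G i)) : malcevQuotientMap h x = x :=
  DFunLike.congr_fun (malcevQuotient_hom_ext (f := malcevQuotientMap h) (g := MonoidHom.id _)
    MalcevCompletion.isUniquelyDivisible fun _ => rfl) x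

/-- If the rational lower central series is stationary from `γₘ` on, then the projection of the
completion onto `G / γₘ ⊗ ℚ` is an isomorphism. -/
noncomputable def completionEquiv (m : ℕ) (hm : ∀ i, gamma G m ≤ gamma G i) :
    QCompletion G ≃* MalcevCompletion (G ⧸ gamma G m) where
  toFun := QCompletion.proj G m
  map_mul' := map_mul _
  invFun y := ⟨fun i => malcevQuotientMap (hm i) y, fun i j h =>
    malcevQuotientMap_comp (gamma_antitone h) (hm j) y⟩
  left_inv x := by
    refine Subtype.ext (funext fun i => ?_)
    change malcevQuotientMap (hm i) (x.1 m) = x.1 i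
    -- Below `m` this is the compatibility of `x`. Above `m`, the component `x.1 m` comes from `x.1
    -- i`, and the round trip through level `m` is the identity.
    rcases le_total i m with h | h
    · exact x.2 i m h
    · rw [← x.2 m i h]
      exact (malcevQuotientMap_comp (hm i) (gamma_antitone h) _).trans (malcevQuotientMap_self _ _)
  right_inv y := malcevQuotientMap_self (hm m) y

/-- The infimum defining the uniformity lies below its `m`-th member, which is discrete because the
projection to level `m` is injective. -/
theorem discreteUniformity_completion (m : ℕ) (hm : ∀ i, gamma G m ≤ gamma G i) :
    DiscreteUniformity (QCompletion G) := by
  constructor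
  rw [eq_bot_iff]
  refine (iInf_le _ m).trans ?_
  rw [le_bot_iff]
  let : UniformSpace (MalcevCompletion (G ⧸ gamma G m)) := ⊥
  have h : Function.Injective (QCompletion.proj G m) := (completionEquiv m hm).injective
  refine UniformSpace.ext ?_
  change Filter.comap _ (Filter.principal _) = Filter.principal _
  rw [Filter.comap_principal]
  congr 1
  ext ⟨a, b⟩
  exact h.eq_iff

variable (S : Type u) [CommRing S] (Γ : Type u) [Group Γ] [UniformSpace Γ]

theorem uniformCochain_eq_top [DiscreteUniformity Γ] (n : ℕ) : uniformCochain S Γ n = ⊤ := by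
  rw [eq_top_iff]
  rintro f -
  change @UniformContinuous (Fin n → Γ) S _ ⊥ f
  have : DiscreteUniformity (Fin n → Γ) := by
    constructor
    -- A finite infimum of principal filters is principal, so a finite power of a discrete
    -- uniformity is discrete.
    refine UniformSpace.ext ?_
    rw [Pi.uniformity]
    simp only [DiscreteUniformity.eq_principal_setRelId, Filter.comap_principal,
      Filter.iInf_principal]
    congr 1
    ext ⟨a, b⟩
    simp [funext_iff]
  exact @DiscreteUniformity.uniformContinuous _ _ _ _ ⊥ f

theorem isCohomologicallyDiscrete_of_discreteUniformity [IsUniformGroup Γ] [DiscreteUniformity Γ] :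
    IsCohomologicallyDiscrete S Γ := by
  intro m
  have : ∀ n, IsIso ((uniformInclusion S Γ).f n) := by
    intro n
    rw [ConcreteCategory.isIso_iff_bijective]
    refine ⟨Subtype.val_injective, fun f => ⟨⟨f, ?_⟩, rfl⟩⟩
    rw [uniformCochain_eq_top]
    exact Submodule.mem_top
  have : IsIso (uniformInclusion S Γ) := HomologicalComplex.Hom.isIso_of_components _
  infer_instance

/-- A homomorphism `f : G → Γ` along which splittings of central extensions of `Γ` by uniquely
divisible groups can be lifted, uniquely. -/
structure LiftsCentralExtensions {Γ : Type u} [Group Γ] (f : G →* Γ) : Prop where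
  exists_section : ∀ (V E : Type u) [CommGroup V] [Group E], IsUniquelyDivisible V →
    ∀ (c : V →* E) (π : E →* Γ), Function.Injective c → (∀ v, c v ∈ Subgroup.center E) →
    Function.Surjective π → c.range = π.ker → ∀ s : G →* E, π.comp s = f →
    ∃ F : Γ →* E, F.comp f = s ∧ π.comp F = MonoidHom.id Γ
  hom_ext : ∀ (V : Type u) [CommGroup V], IsUniquelyDivisible V →
    ∀ F F' : Γ →* V, F.comp f = F'.comp f → F = F'

/-- A central extension of a uniquely divisible group by a uniquely divisible group is uniquely
divisible. -/
theorem IsUniquelyDivisible.of_central_extension {V E Γ : Type u} [CommGroup V] [Group E] [Group Γ]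
    (hV : IsUniquelyDivisible V) (hΓ : IsUniquelyDivisible Γ) (c : V →* E) (π : E →* Γ)
    (hc : Function.Injective c) (hcent : ∀ v, c v ∈ Subgroup.center E)
    (hπ : Function.Surjective π) (hex : c.range = π.ker) : IsUniquelyDivisible E := by
  have hpow : ∀ (x : E) (v : V) (n : ℕ), (x * c v) ^ n = x ^ n * c (v ^ n) := by
    intro x v n
    have h : Commute x (c v) := Subgroup.mem_center_iff.1 (hcent v) x
    rw [h.mul_pow, map_pow]
  have hdiff : ∀ x y : E, π x = π y → ∃ v, x * c v = y := by
    intro x y h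
    have h' : x⁻¹ * y ∈ c.range := by
      rw [hex, MonoidHom.mem_ker, map_mul, map_inv, h, inv_mul_cancel]
    obtain ⟨v, hv⟩ := h'
    exact ⟨v, by rw [hv, mul_inv_cancel_left]⟩
  intro n
  constructor
  · intro x y h
    replace h : x ^ (n : ℕ) = y ^ (n : ℕ) := h
    -- Unique roots in `Γ` reduce to `y = x * c v`; equality of powers then forces `v ^ n = 1`.
    obtain ⟨v, rfl⟩ := hdiff x y ((hΓ n).1 (by
      change π x ^ (n : ℕ) = π y ^ (n : ℕ)
      rw [← map_pow, ← map_pow, h]))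
    rw [hpow, left_eq_mul, ← map_one c] at h
    have hv : v = 1 := (hV n).1 (by
      change v ^ (n : ℕ) = 1 ^ (n : ℕ)
      rw [hc h, one_pow])
    rw [hv, map_one, mul_one]
  · intro e
    -- A root of `π e` is lifted to `x`; the central error between `x ^ n` and `e` is absorbed by
    -- its own root `w`.
    obtain ⟨y, hy⟩ := (hΓ n).2 (π e)
    obtain ⟨x, rfl⟩ := hπ y
    replace hy : π x ^ (n : ℕ) = π e := hy
    rw [← map_pow] at hy
    obtain ⟨v, rfl⟩ := hdiff _ _ hy
    obtain ⟨w, rfl⟩ := (hV n).2 v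
    exact ⟨x * c w, hpow x w n⟩

/-- A homomorphism which maps a stationary term of the rational lower central series into a
central torsion-free subgroup is trivial on it. -/
theorem gamma_le_ker {m : ℕ} (hm : gamma G m = gamma G (m + 1)) {V E : Type u} [CommGroup V]
    [Group E] (hV : IsUniquelyDivisible V) (c : V →* E) (hc : Function.Injective c)
    (hcent : ∀ v, c v ∈ Subgroup.center E) (s : G →* E) (hs : ∀ x ∈ gamma G m, s x ∈ c.range) :
    gamma G m ≤ s.ker := by
  intro x hx
  have hx' : x ∈ rationalStep (gamma G m) := by
    rw [← gamma_succ, ← hm]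
    exact hx
  obtain ⟨n, hn, h⟩ := exists_pow_mem_commutator hx'
  -- The image of γₘ is central. Since γₘ is torsion modulo [γₘ, G], that image is also torsion,
  -- hence trivial in `V`.
  have hcomm : ⁅gamma G m, (⊤ : Subgroup G)⁆ ≤ s.ker := by
    rw [Subgroup.commutator_le]
    intro a ha b _
    obtain ⟨v, hv⟩ := hs a ha
    rw [MonoidHom.mem_ker, map_commutatorElement, commutatorElement_eq_one_iff_mul_comm, ← hv]
    exact (Subgroup.mem_center_iff.1 (hcent v) (s b)).symm
  have h1 : s x ^ n = 1 := by
    rw [← map_pow]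
    exact hcomm h
  obtain ⟨v, hv⟩ := hs x hx
  rw [← hv, ← map_pow, ← map_one c] at h1
  have hv1 : v = 1 := (hV ⟨n, hn⟩).1 (by
    change v ^ n = 1 ^ n
    rw [hc h1, one_pow])
  rw [MonoidHom.mem_ker, ← hv, hv1, map_one]

theorem liftsCentralExtensions_toQCompletion (m : ℕ) (hm : ∀ i, gamma G m ≤ gamma G i) :
    LiftsCentralExtensions (toQCompletion G) := by
  have hm' : gamma G m = gamma G (m + 1) :=
    le_antisymm (hm _) (gamma_antitone (Nat.le_succ m))
  let e := completionEquiv m hm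
  -- Needed for two targets: `V`, and the completion itself, where it shows that `F` splits `π`.
  have hext : ∀ (E : Type u) [Group E], IsUniquelyDivisible E → ∀ F F' : QCompletion G →* E,
      F.comp (toQCompletion G) = F'.comp (toQCompletion G) → F = F' := by
    intro E _ hE F F' h
    have hof : ∀ x : G, e.symm (MalcevCompletion.of (QuotientGroup.mk x)) = toQCompletion G x :=
      fun _ => rfl
    have h1 : F.comp e.symm.toMonoidHom = F'.comp e.symm.toMonoidHom :=
      malcevQuotient_hom_ext hE fun x => DFunLike.congr_fun h x
    ext x
    have h2 := DFunLike.congr_fun h1 (e x)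
    simpa using h2
  have hΓ : IsUniquelyDivisible (QCompletion G) := by
    intro n
    have h := (e.symm.bijective.comp (MalcevCompletion.isUniquelyDivisible n)).comp e.bijective
    convert h using 1
    ext1 x
    simp
  refine ⟨?_, fun V _ hV => hext V hV⟩
  intro V E _ _ hV c π hc hcent hπ hex s hs
  have hE := hV.of_central_extension hΓ c π hc hcent hπ hex
  have hker : gamma G m ≤ s.ker := by
    refine gamma_le_ker hm' hV c hc hcent s fun x hx => ?_
    rw [hex, MonoidHom.mem_ker]
    have h1 : π (s x) = toQCompletion G x := DFunLike.congr_fun hs x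
    rw [h1, ← e.map_eq_one_iff]
    change MalcevCompletion.of (QuotientGroup.mk x : G ⧸ gamma G m) = 1
    rw [(QuotientGroup.eq_one_iff x).2 hx, map_one]
  let F : QCompletion G →* E :=
    (MalcevCompletion.lift hE (QuotientGroup.lift (gamma G m) s hker)).comp e.toMonoidHom
  have hF : F.comp (toQCompletion G) = s := rfl
  refine ⟨F, hF, hext _ hΓ _ _ ?_⟩
  rw [MonoidHom.comp_assoc, hF, hs, MonoidHom.id_comp]

end StableCompletion
-- From central extensions to homology in degrees one and two.
section Homology

open groupHomology

theorem isUniquelyDivisible_multiplicative (k : Type u) [Field k] [CharZero k] (V : Type u)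
    [AddCommGroup V] [Module k V] : IsUniquelyDivisible (Multiplicative V) := by
  intro n
  have hn : (n : k) ≠ 0 := by exact_mod_cast n.ne_zero
  have h : ∀ x : V, (n : ℕ) • x = (n : k) • x := fun x => (Nat.cast_smul_eq_nsmul k _ x).symm
  refine ⟨fun x y hxy => ?_, fun x => ⟨Multiplicative.ofAdd ((n : k)⁻¹ • x.toAdd), ?_⟩⟩
  · have h1 : (n : ℕ) • x.toAdd = (n : ℕ) • y.toAdd := hxy
    rw [h, h] at h1
    exact smul_right_injective V hn h1
  · change (n : ℕ) • ((n : k)⁻¹ • x.toAdd) = x.toAdd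
    rw [h, smul_inv_smul₀ hn]

/-- The central extension of `Γ` by `V` which is defined by a cochain `φ`, as a type. -/
@[ext]
structure CocycleExtension {Γ : Type u} {V : Type u} (φ : Γ → Γ → V) where
  /-- the component in `V` -/
  fst : V
  /-- the component in `Γ` -/
  snd : Γ

namespace CocycleExtension

variable {Γ V : Type u} [Group Γ] [AddCommGroup V] {φ : Γ → Γ → V}

instance : Mul (CocycleExtension φ) := ⟨fun x y => ⟨x.fst + y.fst + φ x.snd y.snd, x.snd * y.snd⟩⟩
-- The cocycle is not assumed normalised, hence the correction by `φ 1 1` here and in the inverse.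
instance : One (CocycleExtension φ) := ⟨⟨-φ 1 1, 1⟩⟩
instance : Inv (CocycleExtension φ) :=
  ⟨fun x => ⟨-x.fst - φ x.snd⁻¹ x.snd - φ 1 1, x.snd⁻¹⟩⟩

theorem mul_fst (x y : CocycleExtension φ) : (x * y).fst = x.fst + y.fst + φ x.snd y.snd := rfl
theorem mul_snd (x y : CocycleExtension φ) : (x * y).snd = x.snd * y.snd := rfl
theorem one_fst : (1 : CocycleExtension φ).fst = -φ 1 1 := rfl
theorem one_snd : (1 : CocycleExtension φ).snd = 1 := rfl
theorem inv_fst (x : CocycleExtension φ) :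
    (x⁻¹).fst = -x.fst - φ x.snd⁻¹ x.snd - φ 1 1 := rfl
theorem inv_snd (x : CocycleExtension φ) : (x⁻¹).snd = x.snd⁻¹ := rfl

variable (hφ : ∀ a b c, φ b c - φ (a * b) c + φ a (b * c) - φ a b = 0)
include hφ

theorem cocycle_one_left (a : Γ) : φ 1 a = φ 1 1 := by
  have h := hφ 1 1 a
  rw [one_mul, one_mul, sub_self, zero_add, sub_eq_zero] at h
  exact h

theorem cocycle_one_right (a : Γ) : φ a 1 = φ 1 1 := by
  have h := hφ a 1 1
  rw [mul_one, mul_one, sub_add_cancel, sub_eq_zero] at h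
  exact h.symm

/-- The group structure on the extension defined by a cocycle. -/
abbrev group : Group (CocycleExtension φ) :=
  Group.ofLeftAxioms
    (by
      intro x y z
      ext
      · simp only [mul_fst, mul_snd]
        have h := hφ x.snd y.snd z.snd
        rw [← sub_eq_zero, ← neg_eq_zero, ← h]
        abel
      · simp only [mul_snd, mul_assoc])
    (by
      intro x
      ext
      · simp only [mul_fst, one_fst, one_snd, cocycle_one_left hφ]
        abel
      · simp only [mul_snd, one_snd, one_mul])
    (by
      intro x
      ext
      · simp only [mul_fst, inv_fst, one_fst, inv_snd]
        abel
      · simp only [mul_snd, inv_snd, one_snd, inv_mul_cancel])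

end CocycleExtension

variable {G Γ : Type u} [Group G] [Group Γ] {f : G →* Γ}

/-- A two-cocycle on `Γ` whose pullback along `f` is a coboundary is a coboundary. -/
theorem LiftsCentralExtensions.exists_primitive (hf : LiftsCentralExtensions f) {V : Type u}
    [AddCommGroup V] (hV : IsUniquelyDivisible (Multiplicative V)) {φ : Γ → Γ → V}
    (hφ : ∀ a b c, φ b c - φ (a * b) c + φ a (b * c) - φ a b = 0) (ψ : G → V)
    (hψ : ∀ a b, φ (f a) (f b) = ψ b - ψ (a * b) + ψ a) :
    ∃ χ : Γ → V, ∀ a b, φ a b = χ b - χ (a * b) + χ a := by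
  let _ := CocycleExtension.group hφ
  -- The shift by `φ 1 1` sends the neutral element of `V` to that of the extension.
  let c : Multiplicative V →* CocycleExtension φ :=
    MonoidHom.mk' (fun v => ⟨v.toAdd - φ 1 1, 1⟩) (by
      intro v w
      ext
      · change v.toAdd + w.toAdd - φ 1 1 = v.toAdd - φ 1 1 + (w.toAdd - φ 1 1) + φ 1 1
        abel
      · exact (mul_one 1).symm)
  let π : CocycleExtension φ →* Γ := MonoidHom.mk' CocycleExtension.snd fun _ _ => rfl
  -- Multiplicativity of `s` is exactly the coboundary equation `hψ`. Conversely, the splitting `F`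
  -- yields the primitive as minus its first component.
  let s : G →* CocycleExtension φ := MonoidHom.mk' (fun g => ⟨-ψ g, f g⟩) (by
    intro a b
    ext
    · change -ψ (a * b) = -ψ a + -ψ b + φ (f a) (f b)
      rw [hψ]
      abel
    · exact map_mul f a b)
  obtain ⟨F, -, hF⟩ := hf.exists_section (Multiplicative V) (CocycleExtension φ) hV c π
    (by
      intro v w h
      have h1 : v.toAdd - φ 1 1 = w.toAdd - φ 1 1 := congrArg CocycleExtension.fst h
      exact sub_left_injective (G := V) h1)
    (by
      intro v
      rw [Subgroup.mem_center_iff]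
      intro x
      ext
      · change x.fst + (v.toAdd - φ 1 1) + φ x.snd 1 = v.toAdd - φ 1 1 + x.fst + φ 1 x.snd
        rw [CocycleExtension.cocycle_one_left hφ x.snd, CocycleExtension.cocycle_one_right hφ x.snd]
        abel
      · exact (mul_one x.snd).trans (one_mul x.snd).symm)
    (fun g => ⟨⟨0, g⟩, rfl⟩)
    (by
      ext x
      constructor
      · rintro ⟨v, rfl⟩
        rfl
      · intro hx
        replace hx : x.snd = 1 := hx
        refine ⟨Multiplicative.ofAdd (x.fst + φ 1 1), ?_⟩
        ext
        · exact add_sub_cancel_right _ _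
        · exact hx.symm)
    s (MonoidHom.ext fun _ => rfl)
  have hsnd : ∀ a, (F a).snd = a := fun a => DFunLike.congr_fun hF a
  refine ⟨fun a => -(F a).fst, fun a b => ?_⟩
  have h := congrArg CocycleExtension.fst (map_mul F a b)
  rw [CocycleExtension.mul_fst, hsnd, hsnd] at h
  change φ a b = -(F b).fst - -(F (a * b)).fst + -(F a).fst
  rw [h]
  abel

/-- Homomorphisms to rational vector spaces extend along `f`. -/
theorem LiftsCentralExtensions.exists_extension (hf : LiftsCentralExtensions f) {V : Type u}
    [CommGroup V] (hV : IsUniquelyDivisible V) (t : G →* V) :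
    ∃ F : Γ →* V, F.comp f = t := by
  -- Lifts of `f` to the trivial extension are homomorphisms `G →* V`.
  obtain ⟨F, hF, -⟩ := hf.exists_section V (V × Γ) hV (MonoidHom.inl V Γ) (MonoidHom.snd V Γ)
    (fun v w h => congrArg Prod.fst h)
    (fun v => Subgroup.mem_center_iff.2 fun x => by
      ext
      · exact mul_comm _ _
      · exact (mul_one x.2).trans (one_mul x.2).symm)
    Prod.snd_surjective
    (by
      ext x
      constructor
      · rintro ⟨v, rfl⟩
        rfl
      · intro hx
        exact ⟨x.1, Prod.ext rfl (Eq.symm hx)⟩)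
    (t.prod f) (MonoidHom.ext fun _ => rfl)
  exact ⟨(MonoidHom.fst V Γ).comp F, by rw [MonoidHom.comp_assoc, hF]; rfl⟩

variable (k : Type u) [Field k]

theorem exists_homologyMap_H1π (f : G →* Γ) (z : cycles₁ (Rep.trivial k G k)) :
    ∃ z' : cycles₁ (Rep.trivial k Γ k), z'.1 = Finsupp.lmapDomain k k f z.1 ∧
      homologyMap k f 1 (H1π _ z) = H1π _ z' :=
  ⟨mapCycles₁ (A := Rep.trivial k G k) (B := Rep.trivial k Γ k) f (𝟙 (Rep.trivial k G k)) z,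
    Finsupp.mapRange_id _, H1π_comp_map_apply (A := Rep.trivial k G k) (B := Rep.trivial k Γ k) f
      (𝟙 (Rep.trivial k G k)) z⟩

theorem exists_homologyMap_H2π (f : G →* Γ) (z : cycles₂ (Rep.trivial k G k)) :
    ∃ z' : cycles₂ (Rep.trivial k Γ k), z'.1 = Finsupp.lmapDomain k k (Prod.map f f) z.1 ∧
      homologyMap k f 2 (H2π _ z) = H2π _ z' :=
  ⟨mapCycles₂ (A := Rep.trivial k G k) (B := Rep.trivial k Γ k) f (𝟙 (Rep.trivial k G k)) z,
    Finsupp.mapRange_id _, H2π_comp_map_apply (A := Rep.trivial k G k) (B := Rep.trivial k Γ k) f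
      (𝟙 (Rep.trivial k G k)) z⟩

/-- The homomorphism `g ↦ [g]` to a quotient of the one-chains by a submodule that contains the
boundaries. -/
noncomputable def classHom (P : Submodule k (G →₀ k)) (hP : boundaries₁ (Rep.trivial k G k) ≤ P) :
    G →* Multiplicative ((G →₀ k) ⧸ P) :=
  MonoidHom.mk' (fun g => Multiplicative.ofAdd (P.mkQ (Finsupp.single g 1))) (by
    intro a b
    change P.mkQ _ = P.mkQ _ + P.mkQ _
    have h : (d₂₁ (Rep.trivial k G k)).hom (Finsupp.single (a, b) 1) ∈ P := hP ⟨_, rfl⟩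
    have h1 : (d₂₁ (Rep.trivial k G k)).hom (Finsupp.single (a, b) (1 : k)) =
      (Finsupp.single b 1 - Finsupp.single (a * b) 1 + Finsupp.single a 1 : G →₀ k) :=
      d₂₁_single (A := Rep.trivial k G k) (a, b) (1 : k)
    rw [h1, ← Submodule.Quotient.mk_eq_zero] at h
    have h2 : P.mkQ (Finsupp.single b 1) - P.mkQ (Finsupp.single (a * b) 1)
      + P.mkQ (Finsupp.single a 1) = 0 := h
    rw [← sub_eq_zero, ← neg_eq_zero, ← h2]
    abel)

/-- The factorisation exists on the range of `p`, and over a field it extends to all of `V`. -/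
theorem exists_comp_eq_of_ker_le_ker {U V W : Type*} [AddCommGroup U] [Module k U]
    [AddCommGroup V] [Module k V] [AddCommGroup W] [Module k W] (p : U →ₗ[k] V) (q : U →ₗ[k] W)
    (h : LinearMap.ker p ≤ LinearMap.ker q) : ∃ r : V →ₗ[k] W, r ∘ₗ p = q := by
  obtain ⟨r, hr⟩ := LinearMap.exists_extend
    ((LinearMap.ker p).liftQ q h ∘ₗ p.quotKerEquivRange.symm.toLinearMap)
  refine ⟨r, LinearMap.ext fun u => ?_⟩
  have h1 := LinearMap.congr_fun hr ⟨p u, u, rfl⟩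
  refine h1.trans ?_
  have h2 : p.quotKerEquivRange.symm ⟨p u, u, rfl⟩ = (LinearMap.ker p).mkQ u := by
    rw [LinearEquiv.symm_apply_eq]
    rfl
  change (LinearMap.ker p).liftQ q h (p.quotKerEquivRange.symm ⟨p u, u, rfl⟩) = q u
  rw [h2]
  rfl

variable [CharZero k]

/-- The tautological homomorphism from `G` to one-chains modulo boundaries extends to `Γ`. Its
linearisation `L` kills boundaries of `Γ`, so it detects the class of any cycle of `G` from its
image. -/
theorem LiftsCentralExtensions.injective_homologyMap_one (hf : LiftsCentralExtensions f) :
    Function.Injective (homologyMap k f 1).hom := by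
  rw [injective_iff_map_eq_zero]
  intro x hx
  induction x using H1_induction_on with
  | h z =>
  obtain ⟨z', hz', hzz'⟩ := exists_homologyMap_H1π k f z
  have h1 : z'.1 ∈ boundaries₁ (Rep.trivial k Γ k) :=
    (H1π_eq_zero_iff z').1 (hzz'.symm.trans hx)
  rw [H1π_eq_zero_iff]
  let B : Submodule k (G →₀ k) := boundaries₁ (Rep.trivial k G k)
  obtain ⟨F, hF⟩ := hf.exists_extension
    (isUniquelyDivisible_multiplicative k ((G →₀ k) ⧸ B)) (classHom k B le_rfl)
  let L : (Γ →₀ k) →ₗ[k] (G →₀ k) ⧸ B :=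
    Finsupp.linearCombination k fun a => Multiplicative.toAdd (F a)
  have hL : L ∘ₗ Finsupp.lmapDomain k k f = B.mkQ := by
    refine Finsupp.lhom_ext' fun a => LinearMap.ext_ring ?_
    simp only [LinearMap.comp_apply, Finsupp.lsingle_apply, Finsupp.lmapDomain_apply,
      Finsupp.mapDomain_single, L, Finsupp.linearCombination_single, one_smul]
    exact DFunLike.congr_fun hF a
  have hLd : L ∘ₗ (d₂₁ (Rep.trivial k Γ k)).hom = 0 := by
    refine Finsupp.lhom_ext' fun a => LinearMap.ext_ring ?_
    have h2 : (d₂₁ (Rep.trivial k Γ k)).hom (Finsupp.single a (1 : k)) =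
      (Finsupp.single a.2 1 - Finsupp.single (a.1 * a.2) 1 + Finsupp.single a.1 1 : Γ →₀ k) :=
      d₂₁_single (A := Rep.trivial k Γ k) a (1 : k)
    have h3 : L (Finsupp.single a.2 1 - Finsupp.single (a.1 * a.2) 1 + Finsupp.single a.1 1) =
        0 := by
      simp only [map_add, map_sub, L, Finsupp.linearCombination_single, one_smul, map_mul,
        toAdd_mul]
      abel
    exact (congrArg L h2).trans h3
  obtain ⟨w, hw⟩ := h1
  have h4 : B.mkQ z.1 = 0 := by
    rw [← hL]
    change L (Finsupp.lmapDomain k k f z.1) = 0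
    rw [← hz', ← hw]
    exact LinearMap.congr_fun hLd w
  exact (Submodule.Quotient.mk_eq_zero B).1 h4

/-- The tautological homomorphism from `Γ` to one-chains modulo `P` is trivial on the image of `f`,
hence trivial by uniqueness of extensions; so `P` is everything. -/
theorem LiftsCentralExtensions.surjective_homologyMap_one (hf : LiftsCentralExtensions f) :
    Function.Surjective (homologyMap k f 1).hom := by
  let B : Submodule k (Γ →₀ k) := boundaries₁ (Rep.trivial k Γ k)
  let P : Submodule k (Γ →₀ k) := B ⊔ LinearMap.range (Finsupp.lmapDomain k k f)
  have h1 : classHom k P le_sup_left = 1 := by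
    refine hf.hom_ext _ (isUniquelyDivisible_multiplicative k _) _ _ ?_
    ext g
    refine (Submodule.Quotient.mk_eq_zero P).2 (Submodule.mem_sup_right ⟨Finsupp.single g 1, ?_⟩)
    simp
  have hP : P = ⊤ := by
    rw [← Submodule.ker_mkQ P, LinearMap.ker_eq_top]
    exact Finsupp.lhom_ext' fun a => LinearMap.ext_ring (DFunLike.congr_fun h1 a)
  intro y
  induction y using H1_induction_on with
  | h y =>
  obtain ⟨b, hb, _, ⟨x, rfl⟩, hxy⟩ := Submodule.mem_sup.1 (hP ▸ Submodule.mem_top : y.1 ∈ P)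
  have hx : x ∈ cycles₁ (Rep.trivial k G k) := by
    rw [cycles₁_eq_top_of_isTrivial]
    exact Submodule.mem_top
  obtain ⟨z', hz', hzz'⟩ := exists_homologyMap_H1π k f ⟨x, hx⟩
  refine ⟨H1π _ ⟨x, hx⟩, hzz'.trans ((H1π_eq_iff _ _).2 ?_)⟩
  have h2 : z'.1 - y.1 = -b := by
    rw [hz', ← hxy]
    abel
  exact h2 ▸ B.neg_mem hb

/-- The projection to two-chains modulo `P` is a two-cocycle on `Γ` whose pullback to `G` vanishes
on cycles, so it is a coboundary on `G` and therefore on `Γ`. A coboundary vanishes on cycles, so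
every cycle of `Γ` lies in `P`. -/
theorem LiftsCentralExtensions.surjective_homologyMap_two (hf : LiftsCentralExtensions f) :
    Function.Surjective (homologyMap k f 2).hom := by
  let B : Submodule k (Γ × Γ →₀ k) := boundaries₂ (Rep.trivial k Γ k)
  let Z : Submodule k (G × G →₀ k) := cycles₂ (Rep.trivial k G k)
  let P : Submodule k (Γ × Γ →₀ k) := B ⊔ Z.map (Finsupp.lmapDomain k k (Prod.map f f))
  let dG : (G × G →₀ k) →ₗ[k] (G →₀ k) := (d₂₁ (Rep.trivial k G k)).hom
  let dΓ : (Γ × Γ →₀ k) →ₗ[k] (Γ →₀ k) := (d₂₁ (Rep.trivial k Γ k)).hom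
  have hdG : ∀ a b : G, dG (Finsupp.single (a, b) 1) =
      Finsupp.single b 1 - Finsupp.single (a * b) 1 + Finsupp.single a 1 := fun a b =>
    d₂₁_single (A := Rep.trivial k G k) (a, b) (1 : k)
  have hdΓ : ∀ a b : Γ, dΓ (Finsupp.single (a, b) 1) =
      Finsupp.single b 1 - Finsupp.single (a * b) 1 + Finsupp.single a 1 := fun a b =>
    d₂₁_single (A := Rep.trivial k Γ k) (a, b) (1 : k)
  have hφ : ∀ a b c : Γ, P.mkQ (Finsupp.single (b, c) 1) - P.mkQ (Finsupp.single (a * b, c) 1) +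
      P.mkQ (Finsupp.single (a, b * c) 1) - P.mkQ (Finsupp.single (a, b) 1) = 0 := by
    intro a b c
    have h1 : (d₃₂ (Rep.trivial k Γ k)).hom (Finsupp.single (a, b, c) (1 : k)) =
        (Finsupp.single (b, c) 1 - Finsupp.single (a * b, c) 1 + Finsupp.single (a, b * c) 1 -
          Finsupp.single (a, b) 1 : Γ × Γ →₀ k) :=
      d₃₂_single (A := Rep.trivial k Γ k) (a, b, c) (1 : k)
    rw [← map_sub, ← map_add, ← map_sub]
    refine (Submodule.Quotient.mk_eq_zero P).2 (Submodule.mem_sup_left ?_)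
    rw [← h1]
    exact ⟨_, rfl⟩
  -- The kernel of `dG` is the space of cycles, whose pushforward lies in `P`; the values of `ψ` on
  -- basis elements are the primitive on `G`.
  obtain ⟨ψ, hψ⟩ := exists_comp_eq_of_ker_le_ker k dG
    (P.mkQ ∘ₗ Finsupp.lmapDomain k k (Prod.map f f)) fun x hx =>
      (Submodule.Quotient.mk_eq_zero P).2 (Submodule.mem_sup_right ⟨x, hx, rfl⟩)
  obtain ⟨χ, hχ⟩ := hf.exists_primitive (isUniquelyDivisible_multiplicative k _)
    (φ := fun a b => P.mkQ (Finsupp.single (a, b) 1)) hφ (fun a => ψ (Finsupp.single a 1)) (by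
      intro a b
      have h := LinearMap.congr_fun hψ (Finsupp.single (a, b) 1)
      rw [LinearMap.comp_apply, hdG, map_add, map_sub] at h
      rw [h]
      simp)
  -- The primitive `χ`, extended linearly, factors the projection through `dΓ`.
  have hX : Finsupp.linearCombination k χ ∘ₗ dΓ = P.mkQ := by
    refine Finsupp.lhom_ext' fun ⟨a, b⟩ => LinearMap.ext_ring ?_
    have h := hχ a b
    simp only [LinearMap.comp_apply, Finsupp.lsingle_apply, hdΓ, map_add, map_sub,
      Finsupp.linearCombination_single, one_smul, h]
  intro y
  induction y using H2_induction_on with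
  | h y =>
  have hy : dΓ y.1 = 0 := y.2
  have hyP : P.mkQ y.1 = 0 := by
    rw [← hX, LinearMap.comp_apply, hy, map_zero]
  obtain ⟨b, hb, _, ⟨x, hx, rfl⟩, hxy⟩ :=
    Submodule.mem_sup.1 ((Submodule.Quotient.mk_eq_zero P).1 hyP)
  obtain ⟨z', hz', hzz'⟩ := exists_homologyMap_H2π k f ⟨x, hx⟩
  refine ⟨H2π _ ⟨x, hx⟩, hzz'.trans ((H2π_eq_iff _ _).2 ?_)⟩
  have h2 : z'.1 - y.1 = -b := by
    rw [hz', ← hxy]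
    abel
  exact h2 ▸ B.neg_mem hb

end Homology
end RationalCompletion

theorem mainTheorem6 {G : Type u} [Group G] [Group.IsSolvable G] (s : ℕ)
    (U : Fin (s + 1) → Subgroup G) [∀ i, (U i).Normal]
    (hanti : Antitone U) (hfirst : U 0 = ⊤) (hlast : U (Fin.last s) = ⊥)
    (hfactor : ∀ i : Fin s, RationalCompletion.IsAbelianOfFiniteRationalRank
      (U i.castSucc ⧸ (U i.succ).subgroupOf (U i.castSucc))) :
    RationalCompletion.IsQPrenilpotent G ∧
    RationalCompletion.IsCohomologicallyDiscrete RationalCompletion.RationalField.{u}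
      (RationalCompletion.QCompletion G) ∧
    (Group.FG G → RationalCompletion.IsHQGood G) := by
  have hpre := RationalCompletion.isQPrenilpotent_of_series s U hfirst hlast hfactor
  refine ⟨hpre, ?_⟩
  obtain ⟨m, hm⟩ := hpre
  -- Stationarity from `m` on and antitonicity before `m` make γₘ the smallest term.
  have hle : ∀ i, RationalCompletion.gamma G m ≤ RationalCompletion.gamma G i := by
    intro i
    rcases le_total m i with h | h
    · induction i, h using Nat.le_induction with
      | base => exact le_rfl
      | succ i hi ih => exact ih.trans (hm i hi).le
    · exact RationalCompletion.gamma_antitone h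
  have := RationalCompletion.discreteUniformity_completion m hle
  have hf := RationalCompletion.liftsCentralExtensions_toQCompletion m hle
  have : CharZero RationalCompletion.RationalField.{u} :=
    charZero_of_injective_ringHom
      (f := ((ULift.ringEquiv (R := ℚ)).symm : ℚ →+* RationalCompletion.RationalField.{u}))
      (ULift.ringEquiv (R := ℚ)).symm.injective
  exact ⟨RationalCompletion.isCohomologicallyDiscrete_of_discreteUniformity _ _, fun _ =>
    ⟨⟨hf.injective_homologyMap_one _, hf.surjective_homologyMap_one _⟩,
      hf.surjective_homologyMap_two _⟩⟩
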